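/- Let $n\ge 1$ be finite. Consider algebras $\mathfrak A=\langle A;\cdot,-,s^i_j,s_{ij}\rangle_{i\ne j<n}$ with $\cdot$ binary and the other operations unary; write $a+b=-(-a\cdot -b)$, $0=a\cdot -a$, and $a\le b$ for $a\cdot b=a$. Let $[i|j]:n\to n$ send $i$ to $j$ and fix everything else, and let $[i,j]$ interchange $i$ and $j$. A set $V\subseteq{}^nU$ is *locally square* if $q\circ[i|j]\in V$ and $q\circ[i,j]\in V$ for all $q\in V$ and $i\neq j<n$; then $\wp(V)$ is the algebra of all subsets of $V$ with intersection, complement relative to $V$, $S^i_jX=\{q\in V:q\circ[i|j]\in X\}$ and $S_{ij}X=\{q\in V:q\circ[i,j]\in X\}$. Let $\Sigma_n$ be the finite set of equations consisting of the Boolean axioms, equations saying that every $s^i_j$ and $s_{ij}$ is a Boolean endomorphism, and the following equations for distinct $i,j,k,l<n$: $s_{ij}x=s_{ji}x$; $s_{ij}s_{ij}x=x$; $s_{ij}s_{ik}s_{ij}x=s_{jk}x$; $s_{ij}s_{kl}x=s_{kl}s_{ij}x$; $s_{kl}s^j_is_{kl}x=s^j_ix$; $s_{jk}s^j_is_{jk}x=s^k_ix$;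 $s_{ki}s^j_is_{ki}x=s^j_kx$; $s_{ij}s^j_is_{ij}x=s^i_jx$; $s^j_is^k_lx=s^k_ls^j_ix$; $s^j_is^k_ix=s^k_is^j_ix=s^j_is^k_jx$; $s^j_is^i_kx=s^j_ks_{ij}x$; $s^j_is^j_kx=s^j_kx$; $s^j_is^j_ix=s^j_ix$; $s^j_is^i_jx=s^j_ix$; $s^j_is_{ij}x=s^j_ix$. Let $SA_n$ be the class of models of $\Sigma_n$, and let $CSA_n$ be the class of *completely representable* algebras in $SA_n$, i.e. those $\mathfrak A\in SA_n$ for which there are a locally square set $V$ and an injective homomorphism $f:\mathfrak A\to\wp(V)$ such that $f(\prod X)=\bigcap_{x\in X}f(x)$ whenever $X\subseteq A$ has a meet $\prod X$ in $\mathfrak A$. Let $\mathrm{At}(x)$ be the formula $x\ne0\wedge\forall y\,(y\le x\to y=0\vee y=x)$, and for distinct $i,j<n$ let $\psi_{i,j}$ be the sentence $\forall y\,\bigl(y\ne0\to\exists x\,(\mathrm{At}(x)\wedge s^i_jx\cdot y\ne0)\bigr)$. **Theorem.** The class $CSA_n$ is elementary and finitely axiomatizable in first-order logic: it is exactly the class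 of models of the finite set of sentences $\Sigma_n\cup\{\forall y\,(y\neq0\to\exists x\,(\mathrm{At}(x)\wedge x\le y))\}\cup\{\psi_{i,j}:i\ne j<n\}$. Thus an atomic algebra in $SA_n$ is completely representable if it satisfies all $\psi_{i,j}$, and conversely every completely representable algebra in $SA_n$ is atomic and satisfies all $\psi_{i,j}$. Moreover, for an atomic $\mathfrak A\in SA_n$ and distinct $i,j<n$, $\mathfrak A\models\psi_{i,j}$ if and only if $s^i_j$ is completely additive in $\mathfrak A$, i.e. preserves every join that exists in $\mathfrak A$. -/

import Mathlib

/-!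
The equations of `Σ_n` present the monoid of all self-maps of `n` by the generators `[i|j]` and
`[i,j]`, so in a model the operations `s^i_j` and `s_{ij}` extend to an action `τ ↦ s_τ` of all
self-maps. The `s_{ij}` are invertible and hence complete; `ψ_{i,j}` says that no nonzero element
is disjoint from all `s^i_j a` with `a` an atom, which in an atomic algebra means that `s^i_j` is
completely additive. If all generators are complete then so is every `s_τ`, and sending `b` to the
set of all pairs `(a, τ)` with `a` an atom and `a ≤ s_τ b` is a complete representation.

Conversely, in a complete representation every point `q` lies in the image of an atom, since
otherwise the elements whose image contains `q` would have meet `0`. This gives atomicity, and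
applied to the point `q ∘ [i|j]` it gives `ψ_{i,j}`.
-/

namespace SubstAlg

open FirstOrder FirstOrder.Language

universe u

/-! ### The similarity type -/

/-- Operation symbols in dimension `n`: Boolean meet and complement, and, for distinct `i j < n`,
the replacement `repl i j` (written `s^i_j`, it belongs to the map `[i|j]` sending `i` to `j` and
fixing everything else) and the transposition `swap i j` (written `s_{ij}`, it belongs to the map
`[i,j]` interchanging `i` and `j`). -/
inductive Op (n : ℕ) : ℕ → Type
  | meet : Op n 2
  | compl : Op n 1
  | repl (i j : Fin n) (h : i ≠ j) : Op n 1
  | swap (i j : Fin n) (h : i ≠ j) : Op n 1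

/-- The first-order language of substitution algebras with transpositions of dimension `n`;
it has no relation symbols. -/
abbrev lang (n : ℕ) : FirstOrder.Language.{0, 0} where
  Functions := Op n
  Relations := fun _ => Empty

/-! ### Concrete set algebras -/

/-- The map `[i|j]`: it sends `i` to `j` and fixes everything else. -/
def replMap {n : ℕ} (i j : Fin n) : Fin n → Fin n := Function.update id i j

/-- `V ⊆ ⁿU` is locally square: closed under composition on the right with all `[i|j]` and
`[i,j]`, `i ≠ j`. -/
def LocallySquare {n : ℕ} {U : Type u} (V : Set (Fin n → U)) : Prop :=
  ∀ i j : Fin n, i ≠ j → ∀ q ∈ V, q ∘ replMap i j ∈ V ∧ q ∘ Equiv.swap i j ∈ V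

/-- The substitution operation on subsets of `V` given by `τ`: `X ↦ {q ∈ V : q ∘ τ ∈ X}`. -/
def setSubst {n : ℕ} {U : Type u} (V : Set (Fin n → U)) (τ : Fin n → Fin n) (X : Set V) : Set V :=
  {q | ∃ p ∈ X, (p : Fin n → U) = (q : Fin n → U) ∘ τ}

/-- The set algebra `℘(V)`: intersection, complement relative to `V`, and the substitutions. -/
instance setAlgebra {n : ℕ} {U : Type u} (V : Set (Fin n → U)) : (lang n).Structure (Set V) where
  funMap {_} f := match f with
    | .meet => fun x => x 0 ∩ x 1
    | .compl => fun x => (x 0)ᶜ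
    | .repl i j _ => fun x => setSubst V (replMap i j) (x 0)
    | .swap i j _ => fun x => setSubst V (Equiv.swap i j) (x 0)
  RelMap {_} r := r.elim

/-! ### Abstract algebras: operations and order -/

/-- The Boolean order: `x ≤ y` iff `x · y = x`. -/
def Le (n : ℕ) {M : Type u} [(lang n).Structure M] (x y : M) : Prop :=
  Structure.funMap (L := lang n) Op.meet ![x, y] = x

/-- `m` is the meet (greatest lower bound) of `X`. -/
def IsMeet (n : ℕ) {M : Type u} [(lang n).Structure M] (X : Set M) (m : M) : Prop :=
  (∀ x ∈ X, Le n m x) ∧ ∀ z, (∀ x ∈ X, Le n z x) → Le n z m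

/-- `m` is the join (least upper bound) of `X`. -/
def IsJoin (n : ℕ) {M : Type u} [(lang n).Structure M] (X : Set M) (m : M) : Prop :=
  (∀ x ∈ X, Le n x m) ∧ ∀ z, (∀ x ∈ X, Le n x z) → Le n m z

/-- The unary operation `s` preserves all joins that exist in the algebra. -/
def CompletelyAdditive (n : ℕ) {M : Type u} [(lang n).Structure M] (s : M → M) : Prop :=
  ∀ (X : Set M) (m : M), IsJoin n X m → IsJoin n (s '' X) (s m)

/-- The replacement operation `s^i_j` of an algebra. -/
def replOp {n : ℕ} (M : Type u) [(lang n).Structure M] (i j : Fin n) (h : i ≠ j) (x : M) : M :=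
  Structure.funMap (L := lang n) (Op.repl i j h) ![x]

/-! ### Terms and formulas -/

section Formulas

variable {n : ℕ} {α : Type}

def tMeet (t u : (lang n).Term α) : (lang n).Term α :=
  Functions.apply₂ (L := lang n) Op.meet t u

def tCompl (t : (lang n).Term α) : (lang n).Term α :=
  Functions.apply₁ (L := lang n) Op.compl t

/-- `t + u` abbreviates `-(-t · -u)`. -/
def tJoin (t u : (lang n).Term α) : (lang n).Term α :=
  tCompl (tMeet (tCompl t) (tCompl u))

/-- `s^i_j t` -/
def tRepl (i j : Fin n) (h : i ≠ j) (t : (lang n).Term α) : (lang n).Term α :=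
  Functions.apply₁ (L := lang n) (Op.repl i j h) t

/-- `s_{ij} t` -/
def tSwap (i j : Fin n) (h : i ≠ j) (t : (lang n).Term α) : (lang n).Term α :=
  Functions.apply₁ (L := lang n) (Op.swap i j h) t

/-- The bound variable number `i`. -/
def var {k : ℕ} (i : Fin k) : (lang n).Term (Empty ⊕ Fin k) := Term.var (Sum.inr i)

/-- The variables of the equations. -/
def x : (lang n).Term (Empty ⊕ Fin 3) := var 0
def y : (lang n).Term (Empty ⊕ Fin 3) := var 1
def z : (lang n).Term (Empty ⊕ Fin 3) := var 2

/-- The universal closure of the equation `t = u` in the variables `x, y, z`. -/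
def eqn (t u : (lang n).Term (Empty ⊕ Fin 3)) : (lang n).Sentence :=
  (t.bdEqual u).alls

/-- `t = 0`, expressed as `t = t · -t`. -/
def isZero {k : ℕ} (t : (lang n).Term (Empty ⊕ Fin k)) : (lang n).BoundedFormula Empty k :=
  t.bdEqual (tMeet t (tCompl t))

/-- `t ≤ u`, expressed as `t · u = t`. -/
def le {k : ℕ} (t u : (lang n).Term (Empty ⊕ Fin k)) : (lang n).BoundedFormula Empty k :=
  (tMeet t u).bdEqual t

/-- `At(v₁)`: the variable number 1 is an atom, i.e. `v₁ ≠ 0 ∧ ∀ v₂ (v₂ ≤ v₁ → v₂ = 0 ∨ v₂ = v₁)`. -/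
def atF : (lang n).BoundedFormula Empty 2 :=
  (isZero (var 1)).not ⊓
    ((le (k := 3) (var 2) (var 1)).imp (isZero (var 2) ⊔ (var 2).bdEqual (var 1))).all

/-- Atomicity: `∀ v₀ (v₀ ≠ 0 → ∃ v₁ (At(v₁) ∧ v₁ ≤ v₀))`. -/
def atomicity : (lang n).Sentence :=
  ((isZero (k := 1) (var 0)).not.imp (atF ⊓ le (var 1) (var 0)).ex).all

/-- The sentence `∀ v₀ (v₀ ≠ 0 → ∃ v₁ (At(v₁) ∧ s^i_j v₁ · v₀ ≠ 0))`. -/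
def psi (i j : Fin n) (h : i ≠ j) : (lang n).Sentence :=
  ((isZero (k := 1) (var 0)).not.imp
    (atF ⊓ (isZero (tMeet (tRepl i j h (var 1)) (var 0))).not).ex).all

end Formulas

/-! ### The equations -/

/-- The equations `Σ_n`: the Boolean axioms in meet and complement; all substitutions are Boolean
endomorphisms; and a presentation of the monoid of all self-maps of `n` in terms of transpositions
and replacements. Different letters `i, j, k, l` stand for distinct indices. -/
inductive SAEq (n : ℕ) : (lang n).Sentence → Prop
  -- Boolean axioms
  | meet_comm : SAEq n (eqn (tMeet x y) (tMeet y x))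
  | meet_assoc : SAEq n (eqn (tMeet (tMeet x y) z) (tMeet x (tMeet y z)))
  | join_comm : SAEq n (eqn (tJoin x y) (tJoin y x))
  | join_assoc : SAEq n (eqn (tJoin (tJoin x y) z) (tJoin x (tJoin y z)))
  | absorb_meet : SAEq n (eqn (tMeet x (tJoin x y)) x)
  | absorb_join : SAEq n (eqn (tJoin x (tMeet x y)) x)
  | distrib : SAEq n (eqn (tMeet x (tJoin y z)) (tJoin (tMeet x y) (tMeet x z)))
  | zero_le : SAEq n (eqn (tMeet (tMeet x (tCompl x)) y) (tMeet x (tCompl x)))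
  | le_one : SAEq n (eqn (tMeet (tJoin x (tCompl x)) y) y)
  -- the substitutions are Boolean endomorphisms
  | swap_meet (i j : Fin n) (h : i ≠ j) :
      SAEq n (eqn (tSwap i j h (tMeet x y)) (tMeet (tSwap i j h x) (tSwap i j h y)))
  | swap_compl (i j : Fin n) (h : i ≠ j) :
      SAEq n (eqn (tSwap i j h (tCompl x)) (tCompl (tSwap i j h x)))
  | repl_meet (i j : Fin n) (h : i ≠ j) :
      SAEq n (eqn (tRepl i j h (tMeet x y)) (tMeet (tRepl i j h x) (tRepl i j h y)))
  | repl_compl (i j : Fin n) (h : i ≠ j) :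
      SAEq n (eqn (tRepl i j h (tCompl x)) (tCompl (tRepl i j h x)))
  -- relations among the transpositions
  | swap_symm (i j : Fin n) (h : i ≠ j) : SAEq n (eqn (tSwap i j h x) (tSwap j i h.symm x))
  | swap_invol (i j : Fin n) (h : i ≠ j) : SAEq n (eqn (tSwap i j h (tSwap i j h x)) x)
  | swap_conj (i j k : Fin n) (hij : i ≠ j) (hik : i ≠ k) (hjk : j ≠ k) :
      SAEq n (eqn (tSwap i j hij (tSwap i k hik (tSwap i j hij x))) (tSwap j k hjk x))
  | swap_swap (i j k l : Fin n) (hij : i ≠ j) (_ : i ≠ k) (_ : i ≠ l) (_ : j ≠ k) (_ : j ≠ l)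
      (hkl : k ≠ l) :
      SAEq n (eqn (tSwap i j hij (tSwap k l hkl x)) (tSwap k l hkl (tSwap i j hij x)))
  -- conjugating replacements by transpositions
  | conj_disjoint (i j k l : Fin n) (hij : i ≠ j) (_ : i ≠ k) (_ : i ≠ l) (_ : j ≠ k) (_ : j ≠ l)
      (hkl : k ≠ l) :
      SAEq n (eqn (tSwap k l hkl (tRepl j i hij.symm (tSwap k l hkl x))) (tRepl j i hij.symm x))
  | conj_source (i j k : Fin n) (hij : i ≠ j) (hik : i ≠ k) (hjk : j ≠ k) :
      SAEq n (eqn (tSwap j k hjk (tRepl j i hij.symm (tSwap j k hjk x))) (tRepl k i hik.symm x))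
  | conj_target (i j k : Fin n) (hij : i ≠ j) (hik : i ≠ k) (hjk : j ≠ k) :
      SAEq n (eqn (tSwap k i hik.symm (tRepl j i hij.symm (tSwap k i hik.symm x)))
        (tRepl j k hjk x))
  | conj_self (i j : Fin n) (hij : i ≠ j) :
      SAEq n (eqn (tSwap i j hij (tRepl j i hij.symm (tSwap i j hij x))) (tRepl i j hij x))
  -- products of replacements
  | repl_disjoint (i j k l : Fin n) (hij : i ≠ j) (_ : i ≠ k) (_ : i ≠ l) (_ : j ≠ k) (_ : j ≠ l)
      (hkl : k ≠ l) :
      SAEq n (eqn (tRepl j i hij.symm (tRepl k l hkl x)) (tRepl k l hkl (tRepl j i hij.symm x)))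
  | repl_same_target (i j k : Fin n) (hij : i ≠ j) (hik : i ≠ k) (_ : j ≠ k) :
      SAEq n (eqn (tRepl j i hij.symm (tRepl k i hik.symm x))
        (tRepl k i hik.symm (tRepl j i hij.symm x)))
  | repl_chain (i j k : Fin n) (hij : i ≠ j) (hik : i ≠ k) (hjk : j ≠ k) :
      SAEq n (eqn (tRepl j i hij.symm (tRepl k i hik.symm x))
        (tRepl j i hij.symm (tRepl k j hjk.symm x)))
  | repl_shift (i j k : Fin n) (hij : i ≠ j) (hik : i ≠ k) (hjk : j ≠ k) :
      SAEq n (eqn (tRepl j i hij.symm (tRepl i k hik x)) (tRepl j k hjk (tSwap i j hij x)))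
  | repl_same_source (i j k : Fin n) (hij : i ≠ j) (_ : i ≠ k) (hjk : j ≠ k) :
      SAEq n (eqn (tRepl j i hij.symm (tRepl j k hjk x)) (tRepl j k hjk x))
  | repl_idem (i j : Fin n) (hij : i ≠ j) :
      SAEq n (eqn (tRepl j i hij.symm (tRepl j i hij.symm x)) (tRepl j i hij.symm x))
  | repl_back (i j : Fin n) (hij : i ≠ j) :
      SAEq n (eqn (tRepl j i hij.symm (tRepl i j hij x)) (tRepl j i hij.symm x))
  | repl_swap (i j : Fin n) (hij : i ≠ j) :
      SAEq n (eqn (tRepl j i hij.symm (tSwap i j hij x)) (tRepl j i hij.symm x))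

/-- The theory `Σ_n`; its (nonempty) models form the variety `SA_n`. -/
def saTheory (n : ℕ) : (lang n).Theory := {φ | SAEq n φ}

/-- `Σ_n` together with atomicity and the sentences `ψ_{i,j}` for distinct `i, j < n`. -/
def csaTheory (n : ℕ) : (lang n).Theory :=
  saTheory n ∪ {atomicity} ∪ {φ | ∃ (i j : Fin n) (h : i ≠ j), φ = psi i j h}

/-! ### Complete representability -/

/-- A complete representation on `V`: an embedding into `℘(V)` carrying every meet that exists
in the algebra to the intersection. -/
def IsCompleteRep {n : ℕ} {M : Type u} [(lang n).Structure M] {U : Type u} (V : Set (Fin n → U))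
    (f : M ↪[lang n] Set V) : Prop :=
  ∀ (X : Set M) (m : M), IsMeet n X m → f m = ⋂ a ∈ X, f a

/-- Membership in `CSA_n`: an algebra of `SA_n` with a complete representation on some
locally square set. -/
def IsCSA (n : ℕ) (M : Type u) [(lang n).Structure M] : Prop :=
  M ⊨ saTheory n ∧
    ∃ (U : Type u) (V : Set (Fin n → U)), LocallySquare V ∧
      ∃ f : M ↪[lang n] Set V, IsCompleteRep V f

end SubstAlg

namespace SubstAlg

open FirstOrder FirstOrder.Language

universe u

/-! ### A presentation of the monoid of self-maps of a finite set -/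

section SelfMaps

variable {α : Type*}

theorem end_mul_apply (f g : Function.End α) (a : α) : (f * g) a = f (g a) := rfl

theorem end_one_apply (a : α) : (1 : Function.End α) a = a := rfl

/-- The submonoid generated by the transpositions of two elements of `F`. -/
def swapSubmonoid {N : Type*} [Monoid N] (s : α → α → N) (F : Set α) : Submonoid N :=
  .closure {m | ∃ k ∈ F, ∃ l ∈ F, m = s k l}

/-- The submonoid generated by all transpositions and replacements. -/
def substSubmonoid {N : Type*} [Monoid N] (s r : α → α → N) : Submonoid N :=
  .closure {m | ∃ i j, m = s i j ∨ m = r i j}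

section Generators

variable {N : Type*} [Monoid N] {s r : α → α → N}

theorem swap_mem_substSubmonoid (i j : α) : s i j ∈ substSubmonoid s r :=
  Submonoid.subset_closure ⟨i, j, .inl rfl⟩

theorem repl_mem_substSubmonoid (i j : α) : r i j ∈ substSubmonoid s r :=
  Submonoid.subset_closure ⟨i, j, .inr rfl⟩

theorem swap_mem_swapSubmonoid {F : Set α} {k l : α} (hk : k ∈ F) (hl : l ∈ F) :
    s k l ∈ swapSubmonoid s F :=
  Submonoid.subset_closure ⟨k, hk, l, hl, rfl⟩

end Generators

variable [DecidableEq α]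

/-- The transposition `[i,j]` as an element of the monoid of self-maps. -/
def swapEnd (i j : α) : Function.End α := ⇑(Equiv.swap i j)

/-- The replacement `[i|j]` as an element of the monoid of self-maps. -/
def replEnd (i j : α) : Function.End α := Function.update id i j

theorem replEnd_self (i : α) : replEnd i i = 1 := Function.update_eq_self i id

theorem swapEnd_apply (i j a : α) : swapEnd i j a = Equiv.swap i j a := rfl

theorem replEnd_apply (i j a : α) : replEnd i j a = if a = i then j else a :=
  Function.update_apply id i j a

theorem replEnd_apply_self (i j : α) : replEnd i j i = j := Function.update_self ..

theorem replEnd_apply_of_ne {i a : α} (h : a ≠ i) (j : α) : replEnd i j a = a :=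
  Function.update_of_ne h ..

/-- The relations satisfied by transpositions `s i j` and replacements `r i j`. Unlike in `Σ_n`,
the indices may coincide, with `s i i = r i i = 1`; the relations for conjugation by transpositions
then become two uniform equivariance laws. -/
structure SubstRelations {N : Type*} [Monoid N] (s r : α → α → N) : Prop where
  swap_self (i : α) : s i i = 1
  repl_self (i : α) : r i i = 1
  swap_mul_self (i j : α) : s i j * s i j = 1
  swap_mul_swap (k l i j : α) :
    s k l * s i j = s (Equiv.swap k l i) (Equiv.swap k l j) * s k l
  swap_mul_repl (k l i j : α) :
    s k l * r i j = r (Equiv.swap k l i) (Equiv.swap k l j) * s k l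
  repl_comm {i j k l : α} : i ≠ k → i ≠ l → j ≠ k → r i j * r k l = r k l * r i j
  repl_same_source {i k : α} (j : α) : i ≠ k → r i j * r i k = r i k
  repl_same_target (i j k : α) : r i j * r k j = r i j * r k i
  repl_mul_swap (i j : α) : r i j * s i j = r i j

theorem substRelations_end : SubstRelations (swapEnd (α := α)) (replEnd (α := α)) := by
  constructor <;> intros <;> funext a <;>
    simp only [end_mul_apply, end_one_apply, swapEnd_apply, replEnd_apply,
      Equiv.swap_apply_def] <;> grind

namespace SubstRelations

variable {N : Type*} [Monoid N] {s r : α → α → N}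

theorem prod {N' : Type*} [Monoid N'] {s' r' : α → α → N'} (h : SubstRelations s r)
    (h' : SubstRelations s' r') :
    SubstRelations (fun i j => (s i j, s' i j)) (fun i j => (r i j, r' i j)) where
  swap_self i := Prod.ext (h.swap_self i) (h'.swap_self i)
  repl_self i := Prod.ext (h.repl_self i) (h'.repl_self i)
  swap_mul_self i j := Prod.ext (h.swap_mul_self i j) (h'.swap_mul_self i j)
  swap_mul_swap k l i j := Prod.ext (h.swap_mul_swap k l i j) (h'.swap_mul_swap k l i j)
  swap_mul_repl k l i j := Prod.ext (h.swap_mul_repl k l i j) (h'.swap_mul_repl k l i j)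
  repl_comm hik hil hjk := Prod.ext (h.repl_comm hik hil hjk) (h'.repl_comm hik hil hjk)
  repl_same_source j hik := Prod.ext (h.repl_same_source j hik) (h'.repl_same_source j hik)
  repl_same_target i j k := Prod.ext (h.repl_same_target i j k) (h'.repl_same_target i j k)
  repl_mul_swap i j := Prod.ext (h.repl_mul_swap i j) (h'.repl_mul_swap i j)

section Relations

variable (h : SubstRelations s r)
include h

theorem swap_symm (i j : α) : s i j = s j i := by
  have hij : s i j * s i j = s j i * s i j := by
    simpa only [Equiv.swap_apply_left, Equiv.swap_apply_right] using h.swap_mul_swap i j i j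
  rw [← mul_one (s i j), ← h.swap_mul_self i j, ← mul_assoc, hij, mul_assoc, h.swap_mul_self,
    mul_one]

theorem repl_eq_swap_mul_repl (i j : α) : r i j = s i j * r j i := by
  rw [h.swap_mul_repl, Equiv.swap_apply_left, Equiv.swap_apply_right, h.repl_mul_swap]

theorem repl_mul_self (i j : α) : r i j * r i j = r i j := by
  rw [h.repl_same_target, h.repl_self, mul_one]

theorem repl_mul_repl_mul_repl (k l i j : α) :
    r (replEnd k l i) (replEnd k l j) * (r k l * r i j) =
      r (replEnd k l i) (replEnd k l j) * r k l := by
  obtain rfl | hij := eq_or_ne i j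
  · rw [h.repl_self, h.repl_self, mul_one]
  obtain rfl | hkl := eq_or_ne k l
  · rw [replEnd_self, end_one_apply, end_one_apply, h.repl_self, one_mul, mul_one, h.repl_mul_self]
  obtain rfl | hik := eq_or_ne i k
  · rw [replEnd_apply_self, replEnd_apply_of_ne hij.symm, h.repl_same_source l hij,
      h.repl_same_target]
  obtain rfl | hjk := eq_or_ne j k
  · rw [replEnd_apply_self, replEnd_apply_of_ne hij, ← h.repl_same_target]
    obtain rfl | hil := eq_or_ne i l
    · rw [h.repl_self, mul_one]
    · rw [h.repl_comm hij.symm hkl hil.symm, ← mul_assoc, h.repl_mul_self]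
  rw [replEnd_apply_of_ne hik, replEnd_apply_of_ne hjk]
  obtain rfl | hil := eq_or_ne i l
  · rw [← mul_assoc, ← h.repl_same_target, mul_assoc, h.repl_comm hik.symm hjk.symm hij.symm,
      ← mul_assoc, h.repl_mul_self]
  · rw [h.repl_comm hik.symm hjk.symm hil.symm, ← mul_assoc, h.repl_mul_self]

theorem exists_swap_mul_swap {F : Set α} {a i j q : α} (ha : a ∉ F) (hi : i ∈ insert a F)
    (hj : j ∈ insert a F) (hq : q ∈ insert a F) :
    ∃ q' ∈ insert a F, ∃ t ∈ swapSubmonoid s F, s i j * s a q = s a q' * t := by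
  obtain rfl | hij := eq_or_ne i j
  · exact ⟨q, hq, 1, one_mem _, by rw [h.swap_self, one_mul, mul_one]⟩
  by_cases haij : a = i ∨ a = j
  · obtain ⟨b, hb, hba, hs⟩ : ∃ b ∈ F, b ≠ a ∧ s i j = s a b := by
      rcases haij with rfl | rfl
      · exact ⟨j, hj.resolve_left hij.symm, hij.symm, rfl⟩
      · exact ⟨i, hi.resolve_left hij, hij, h.swap_symm i a⟩
    rw [hs]
    obtain rfl | hqF := hq
    · exact ⟨b, .inr hb, 1, one_mem _, by rw [h.swap_self]⟩
    obtain rfl | hbq := eq_or_ne b q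
    · exact ⟨a, .inl rfl, 1, one_mem _, by rw [h.swap_mul_self, h.swap_self, mul_one]⟩
    · refine ⟨q, .inr hqF, s q b, swap_mem_swapSubmonoid hqF hb, ?_⟩
      rw [h.swap_mul_swap a q, Equiv.swap_apply_right, Equiv.swap_apply_of_ne_of_ne hba hbq]
  · rw [not_or] at haij
    have hiF := hi.resolve_left (Ne.symm haij.1)
    have hjF := hj.resolve_left (Ne.symm haij.2)
    refine ⟨Equiv.swap i j q, ?_, s i j, swap_mem_swapSubmonoid hiF hjF, ?_⟩
    · rw [Equiv.swap_apply_def]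
      split_ifs <;> assumption
    · rw [h.swap_mul_swap, Equiv.swap_apply_of_ne_of_ne haij.1 haij.2]

theorem exists_eq_swap_mul {F : Set α} {a : α} (ha : a ∉ F) {p : N}
    (hp : p ∈ swapSubmonoid s (insert a F)) :
    ∃ q ∈ insert a F, ∃ t ∈ swapSubmonoid s F, p = s a q * t := by
  induction hp using Submonoid.closure_induction_left with
  | one => exact ⟨a, .inl rfl, 1, one_mem _, by rw [h.swap_self, mul_one]⟩
  | mul_left g hg p _ ih =>
    obtain ⟨i, hi, j, hj, rfl⟩ := hg
    obtain ⟨q, hq, t, ht, rfl⟩ := ih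
    obtain ⟨q', hq', t', ht', hmul⟩ := h.exists_swap_mul_swap ha hi hj hq
    exact ⟨q', hq', t' * t, mul_mem ht' ht, by rw [← mul_assoc, hmul, mul_assoc]⟩

theorem exists_inverse {F : Set α} {p : N} (hp : p ∈ swapSubmonoid s F) :
    ∃ q ∈ swapSubmonoid s F, p * q = 1 ∧ q * p = 1 := by
  induction hp using Submonoid.closure_induction_left with
  | one => exact ⟨1, one_mem _, one_mul 1, one_mul 1⟩
  | mul_left g hg p _ ih =>
    obtain ⟨k, hk, l, hl, rfl⟩ := hg
    obtain ⟨q, hq, hpq, hqp⟩ := ih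
    refine ⟨q * s k l, mul_mem hq (swap_mem_swapSubmonoid hk hl), ?_, ?_⟩
    · rw [mul_assoc, ← mul_assoc p, hpq, one_mul, h.swap_mul_self]
    · rw [mul_assoc, ← mul_assoc (s k l), h.swap_mul_self, one_mul, hqp]

end Relations

section Action

variable {φ : N →* Function.End α}

theorem map_apply_of_notMem (hs : ∀ i j, φ (s i j) = swapEnd i j) {F : Set α} {p : N}
    (hp : p ∈ swapSubmonoid s F) {a : α} (ha : a ∉ F) : φ p a = a := by
  induction hp using Submonoid.closure_induction_left with
  | one => rw [map_one, end_one_apply]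
  | mul_left g hg p _ ih =>
    obtain ⟨k, hk, l, hl, rfl⟩ := hg
    rw [map_mul, end_mul_apply, ih, hs, swapEnd_apply,
      Equiv.swap_apply_of_ne_of_ne (ne_of_mem_of_not_mem hk ha).symm
        (ne_of_mem_of_not_mem hl ha).symm]

variable (h : SubstRelations s r)
include h

theorem mem_swapSubmonoid_compl (hs : ∀ i j, φ (s i j) = swapEnd i j) {p : N}
    (hp : p ∈ swapSubmonoid s Set.univ) {C : Set α} (hC : C.Finite) (hfix : ∀ a ∈ C, φ p a = a) :
    p ∈ swapSubmonoid s Cᶜ := by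
  induction C, hC using Set.Finite.induction_on with
  | empty => rwa [Set.compl_empty]
  | @insert a C ha _ ih =>
    have hins : Cᶜ = insert a (insert a C)ᶜ := by grind
    have haC : a ∉ (insert a C)ᶜ := fun hmem => hmem (Set.mem_insert a C)
    have hpC := ih fun b hb => hfix b (Set.mem_insert_of_mem a hb)
    obtain ⟨q, -, t, ht, rfl⟩ := h.exists_eq_swap_mul haC (hins ▸ hpC)
    have hqa : q = a := by
      simpa only [map_mul, end_mul_apply, map_apply_of_notMem hs ht haC, hs, swapEnd_apply,
        Equiv.swap_apply_left] using hfix a (Set.mem_insert a C)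
    rwa [hqa, h.swap_self, one_mul]

variable (hs : ∀ i j, φ (s i j) = swapEnd i j) (hr : ∀ i j, φ (r i j) = replEnd i j)
include hs hr

theorem repl_mul_of_notMem_range {m : N} (hm : m ∈ substSubmonoid s r) {p : α}
    (hp : p ∉ Set.range (φ m)) (q : α) : r p q * m = m := by
  induction hm using Submonoid.closure_induction_left generalizing p q with
  | one => exact absurd ⟨p, by rw [map_one, end_one_apply]⟩ hp
  | mul_left g hg m _ ih =>
    obtain ⟨k, l, rfl | rfl⟩ := hg
    · have hp' : Equiv.swap k l p ∉ Set.range (φ m) := fun ⟨a, ha⟩ => hp ⟨a, by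
        rw [map_mul, end_mul_apply, ha, hs, swapEnd_apply, Equiv.swap_apply_self]⟩
      have hpq := h.swap_mul_repl k l (Equiv.swap k l p) (Equiv.swap k l q)
      rw [Equiv.swap_apply_self, Equiv.swap_apply_self] at hpq
      rw [← mul_assoc, ← hpq, mul_assoc, ih hp']
    have hp_of_map {a b : α} (ha : φ m b = a) (hap : replEnd k l a = p) : False :=
      hp ⟨b, by rw [map_mul, end_mul_apply, ha, hr, hap]⟩
    obtain rfl | hkl := eq_or_ne k l
    · rw [h.repl_self, one_mul]
      exact ih (fun ⟨b, hb⟩ => hp_of_map hb (by rw [replEnd_self, end_one_apply])) q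
    obtain rfl | hpk := eq_or_ne p k
    · rw [← mul_assoc, h.repl_same_source q hkl]
    have hpm : p ∉ Set.range (φ m) := fun ⟨b, hb⟩ => hp_of_map hb (replEnd_apply_of_ne hpk l)
    obtain rfl | hpl := eq_or_ne p l
    · rw [ih (fun ⟨b, hb⟩ => hp_of_map hb (replEnd_apply_self k p)) p, ih hpm q]
    · calc r p q * (r k l * m)
          = r p q * (r k l * (r p l * m)) := by rw [ih hpm l]
        _ = r p q * r p l * (r k l * m) := by
          rw [← mul_assoc (r k l), h.repl_comm hpk.symm hkl hpl.symm, mul_assoc, mul_assoc]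
        _ = r k l * (r p l * m) := by
          rw [h.repl_same_source q hpl, ← mul_assoc, ← h.repl_comm hpk.symm hkl hpl.symm,
            mul_assoc]
        _ = r k l * m := by rw [ih hpm l]

theorem swap_mul_of_notMem_range {m : N} (hm : m ∈ substSubmonoid s r) {k l : α}
    (hk : k ∉ Set.range (φ m)) (hl : l ∉ Set.range (φ m)) : s k l * m = m := by
  obtain rfl | hkl := eq_or_ne k l
  · rw [h.swap_self, one_mul]
  obtain ⟨a, hka, hla⟩ : ∃ a, k ≠ a ∧ l ≠ a :=
    ⟨φ m k, fun hak => hk ⟨k, hak.symm⟩, fun hal => hl ⟨k, hal.symm⟩⟩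
  have hm' : r k a * (r l a * m) = m := by
    rw [h.repl_mul_of_notMem_range hs hr hm hl, h.repl_mul_of_notMem_range hs hr hm hk]
  have hcomm := h.repl_comm hkl hka hla.symm
  have hswap : s k l * (r k a * r l a) = r k a * r l a := calc
    s k l * (r k a * r l a) = r l a * r k a * s k l := by
      rw [← mul_assoc, h.swap_mul_repl, mul_assoc, h.swap_mul_repl, ← mul_assoc,
        Equiv.swap_apply_left, Equiv.swap_apply_right,
        Equiv.swap_apply_of_ne_of_ne hka.symm hla.symm]
    _ = r l a * r k a := by rw [h.repl_same_target, mul_assoc, h.repl_mul_swap]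
    _ = r k a * r l a := hcomm.symm
  rw [← hm', ← mul_assoc (r k a), ← mul_assoc, hswap]

theorem mul_repl_of_map_eq {m : N} (hm : m ∈ substSubmonoid s r) {i j : α}
    (hij : φ m i = φ m j) : m * r i j = m := by
  induction hm using Submonoid.closure_induction_right generalizing i j with
  | one =>
    rw [map_one, end_one_apply, end_one_apply] at hij
    rw [hij, h.repl_self, one_mul]
  | mul_right m _ g hg ih =>
    rw [map_mul, end_mul_apply, end_mul_apply] at hij
    obtain ⟨k, l, rfl | rfl⟩ := hg
    · rw [hs, swapEnd_apply, swapEnd_apply] at hij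
      rw [mul_assoc, h.swap_mul_repl, ← mul_assoc, ih hij]
    · rw [hr] at hij
      rw [← ih hij, mul_assoc, mul_assoc, mul_assoc, h.repl_mul_repl_mul_repl]

theorem mul_of_mem_closure_repl {m e : N} (hm : m ∈ substSubmonoid s r)
    (he : e ∈ Submonoid.closure {g | ∃ i j, φ m i = φ m j ∧ g = r i j}) : m * e = m := by
  induction he using Submonoid.closure_induction_left with
  | one => exact mul_one m
  | mul_left g hg e _ ih =>
    obtain ⟨i, j, hij, rfl⟩ := hg
    rw [← mul_assoc, h.mul_repl_of_map_eq hs hr hm hij, ih]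

theorem exists_swapSubmonoid_mul_eq {u m : N} (hu : u ∈ substSubmonoid s r)
    (hm : m ∈ substSubmonoid s r) (hinj : Set.InjOn (φ u) (Set.range (φ m))) :
    ∃ p ∈ swapSubmonoid s Set.univ, u * m = p * m := by
  induction hu using Submonoid.closure_induction_left with
  | one => exact ⟨1, one_mem _, rfl⟩
  | mul_left g hg u hu ih =>
    rw [map_mul] at hinj
    obtain ⟨p, hp, hup⟩ := ih fun a ha b hb hab => hinj ha hb (congrArg (φ g) hab)
    obtain ⟨k, l, rfl | rfl⟩ := hg
    · exact ⟨s k l * p, mul_mem (swap_mem_swapSubmonoid trivial trivial) hp, by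
        rw [mul_assoc, hup, mul_assoc]⟩
    have hum : u * m ∈ substSubmonoid s r := mul_mem hu hm
    obtain rfl | hkl := eq_or_ne k l
    · exact ⟨p, hp, by rw [h.repl_self, one_mul, hup]⟩
    by_cases hk : k ∈ Set.range (φ (u * m))
    · have hl : l ∉ Set.range (φ (u * m)) := by
        rintro ⟨b, hb⟩
        obtain ⟨a, ha⟩ := hk
        rw [map_mul, end_mul_apply] at ha hb
        have hab : φ m a = φ m b := hinj ⟨a, rfl⟩ ⟨b, rfl⟩ (by
          rw [end_mul_apply, end_mul_apply, ha, hb, hr, replEnd_apply_self,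
            replEnd_apply_of_ne hkl.symm])
        exact hkl (by rw [← ha, ← hb, hab])
      refine ⟨s k l * p, mul_mem (swap_mem_swapSubmonoid trivial trivial) hp, ?_⟩
      rw [mul_assoc, h.repl_eq_swap_mul_repl, mul_assoc,
        h.repl_mul_of_notMem_range hs hr hum hl, hup, mul_assoc]
    · exact ⟨p, hp, by rw [mul_assoc, h.repl_mul_of_notMem_range hs hr hum hk, hup]⟩

theorem mul_eq_of_fixes_range [Finite α] {p m : N} (hp : p ∈ swapSubmonoid s Set.univ)
    (hm : m ∈ substSubmonoid s r) (hfix : ∀ a, φ p (φ m a) = φ m a) : p * m = m := by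
  have hmem := h.mem_swapSubmonoid_compl hs hp (Set.finite_range (φ m)) (by
    rintro _ ⟨a, rfl⟩
    exact hfix a)
  clear hp hfix
  induction hmem using Submonoid.closure_induction_left with
  | one => exact one_mul m
  | mul_left g hg p _ ih =>
    obtain ⟨k, hk, l, hl, rfl⟩ := hg
    rw [mul_assoc, ih, h.swap_mul_of_notMem_range hs hr hm hk hl]

omit h hs in
theorem exists_closure_repl_injOn_range [Finite α] (f : α → α) :
    ∃ e ∈ Submonoid.closure {g | ∃ i j, f i = f j ∧ g = r i j},
      Set.InjOn f (Set.range (φ e)) := by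
  obtain ⟨e, he, hmin⟩ := exists_minimalFor_of_wellFoundedLT
    (· ∈ Submonoid.closure {g | ∃ i j, f i = f j ∧ g = r i j})
    (fun e => (Set.range (φ e)).ncard) ⟨1, one_mem _⟩
  refine ⟨e, he, fun i hi j hj hij => by_contra fun hne => ?_⟩
  have hsub : Set.range (φ (r i j * e)) ⊂ Set.range (φ e) := by
    refine Set.ssubset_iff_of_subset ?_ |>.2 ⟨i, hi, ?_⟩
    · rintro _ ⟨a, rfl⟩
      rw [map_mul, end_mul_apply, hr, replEnd_apply]
      split_ifs
      exacts [hj, ⟨a, rfl⟩]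
    · rintro ⟨a, ha⟩
      rw [map_mul, end_mul_apply, hr, replEnd_apply] at ha
      split_ifs at ha with hai
      exacts [hne ha.symm, hai ha]
  have hlt := Set.ncard_lt_ncard hsub
  exact hlt.not_ge (hmin (mul_mem (Submonoid.subset_closure ⟨i, j, hij, rfl⟩) he) hlt.le)

/- If `φ m = φ m'`, both `m` and `m'` absorb on the right an element `e` whose range is a
transversal of the kernel of `φ m`, and on that range both act as products of transpositions. -/
theorem injOn_substSubmonoid [Finite α] : Set.InjOn φ (substSubmonoid s r : Set N) := by
  intro m hm m' hm' hmm'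
  obtain ⟨e, he, hinj⟩ := exists_closure_repl_injOn_range hr (φ m)
  have hme : m * e = m := h.mul_of_mem_closure_repl hs hr hm he
  have hme' : m' * e = m' := h.mul_of_mem_closure_repl hs hr hm' (hmm' ▸ he)
  have hemem : e ∈ substSubmonoid s r := by
    refine Submonoid.closure_mono ?_ he
    rintro _ ⟨i, j, -, rfl⟩
    exact ⟨i, j, .inr rfl⟩
  obtain ⟨p, hp, hpe⟩ := h.exists_swapSubmonoid_mul_eq hs hr hm hemem hinj
  obtain ⟨p', hp', hpe'⟩ := h.exists_swapSubmonoid_mul_eq hs hr hm' hemem (hmm' ▸ hinj)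
  obtain ⟨q, hq, hpq, hqp⟩ := h.exists_inverse hp
  have hφ : φ (q * p' * e) = φ e := by
    rw [mul_assoc, ← hpe', hme', map_mul, ← hmm', ← map_mul, ← hme, hpe, ← mul_assoc, hqp, one_mul]
  have hqp' : q * p' * e = e := h.mul_eq_of_fixes_range hs hr (mul_mem hq hp') hemem fun a => by
    have hφa := congrFun hφ a
    rwa [map_mul] at hφa
  calc m = p * e := by rw [← hpe, hme]
    _ = p * q * (p' * e) := by rw [mul_assoc, ← mul_assoc q, hqp']
    _ = m' := by rw [hpq, one_mul, ← hpe', hme']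

end Action

end SubstRelations

theorem toEndHom_mem_substSubmonoid [Finite α] (σ : Equiv.Perm α) :
    MulAction.toEndHom σ ∈ substSubmonoid (swapEnd (α := α)) replEnd := by
  induction σ using Equiv.Perm.swap_induction_on with
  | one => exact one_mem _
  | swap_mul σ i j _ ih =>
    rw [map_mul]
    exact mul_mem (swap_mem_substSubmonoid i j) ih

/- A map `f` identifying `i ≠ j` misses some `p`. It is `[p | f i]` after the map that differs from
`f` only in sending `i` to `p`, whose range is larger. -/
theorem substSubmonoid_end_eq_top [Finite α] :
    substSubmonoid (swapEnd (α := α)) replEnd = ⊤ := by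
  refine (Submonoid.eq_top_iff' _).2 fun f => ?_
  induction hc : (Set.range f)ᶜ.ncard using Nat.strong_induction_on generalizing f with
  | _ c ih =>
    by_cases hf : Function.Injective f
    · exact toEndHom_mem_substSubmonoid (.ofBijective f (Finite.injective_iff_bijective.1 hf))
    obtain ⟨i, j, hij, hne⟩ := Function.not_injective_iff.1 hf
    obtain ⟨p, hp⟩ := not_forall.1 (mt Finite.injective_iff_surjective.2 hf)
    let g : Function.End α := Function.update f i p
    have hgi : g i = p := Function.update_self ..
    have hg {a : α} (ha : a ≠ i) : g a = f a := Function.update_of_ne ha ..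
    have hfg : f = replEnd p (f i) * g := by
      funext a
      obtain rfl | ha := eq_or_ne a i
      · rw [end_mul_apply, hgi, replEnd_apply_self]
      · rw [end_mul_apply, hg ha, replEnd_apply_of_ne fun hap => hp ⟨a, hap⟩]
    have hsub : (Set.range g)ᶜ ⊂ (Set.range f)ᶜ := by
      refine compl_lt_compl_iff_lt.2 (Set.ssubset_iff_of_subset ?_ |>.2 ⟨p, ⟨i, hgi⟩, hp⟩)
      rintro _ ⟨a, rfl⟩
      obtain rfl | ha := eq_or_ne a i
      exacts [⟨j, by rw [hg hne.symm, hij]⟩, ⟨a, hg ha⟩]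
    rw [hfg]
    exact mul_mem (repl_mem_substSubmonoid p _) (ih _ (hc ▸ Set.ncard_lt_ncard hsub) g rfl)

theorem SubstRelations.exists_monoidHom [Finite α] {N : Type*} [Monoid N] {s r : α → α → N}
    (h : SubstRelations s r) : ∃ F : Function.End α →* N,
      (∀ i j, F (swapEnd i j) = s i j) ∧ ∀ i j, F (replEnd i j) = r i j := by
  let S := substSubmonoid (fun i j => (swapEnd i j, s i j)) fun i j : α => (replEnd i j, r i j)
  let π : S →* Function.End α := (MonoidHom.fst _ _).comp S.subtype
  have hinj : Function.Injective π := fun m m' hmm' => Subtype.ext <|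
    (substRelations_end.prod h).injOn_substSubmonoid (φ := .fst _ _) (fun _ _ => rfl)
      (fun _ _ => rfl) m.2 m'.2 hmm'
  have hsurj : Function.Surjective π := by
    have hle : substSubmonoid swapEnd replEnd ≤ MonoidHom.mrange π := by
      refine Submonoid.closure_le.2 ?_
      rintro _ ⟨i, j, rfl | rfl⟩
      exacts [⟨⟨_, swap_mem_substSubmonoid i j⟩, rfl⟩, ⟨⟨_, repl_mem_substSubmonoid i j⟩, rfl⟩]
    rw [substSubmonoid_end_eq_top, top_le_iff] at hle
    exact MonoidHom.mrange_eq_top.1 hle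
  let E := MulEquiv.ofBijective π ⟨hinj, hsurj⟩
  have hE (m : S) : (E.symm (m : Function.End α × N).1 : Function.End α × N) = m :=
    congrArg Subtype.val (E.symm_apply_apply m)
  exact ⟨((MonoidHom.snd _ _).comp S.subtype).comp E.symm.toMonoidHom,
    fun i j => congrArg Prod.snd (hE ⟨_, swap_mem_substSubmonoid i j⟩),
    fun i j => congrArg Prod.snd (hE ⟨_, repl_mem_substSubmonoid i j⟩)⟩

theorem map_mem_of_swap_of_repl [Finite α] {N : Type*} [Monoid N] (F : Function.End α →* N)
    {T : Submonoid N} (hs : ∀ i j, F (swapEnd i j) ∈ T) (hr : ∀ i j, F (replEnd i j) ∈ T)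
    (τ : Function.End α) : F τ ∈ T := by
  have hle : substSubmonoid swapEnd replEnd ≤ T.comap F := by
    refine Submonoid.closure_le.2 ?_
    rintro _ ⟨i, j, rfl | rfl⟩
    exacts [hs i j, hr i j]
  exact hle (substSubmonoid_end_eq_top (α := α) ▸ Submonoid.mem_top τ)

end SelfMaps

/-! ### Complete Boolean endomorphisms -/

section BooleanHoms

variable {B B' : Type*} [BooleanAlgebra B] [BooleanAlgebra B']

/-- A map preserving binary meets and complements, as a homomorphism of bounded lattices. -/
def latticeHomOfInfCompl (f : B → B') (hinf : ∀ a b, f (a ⊓ b) = f a ⊓ f b)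
    (hcompl : ∀ a, f aᶜ = (f a)ᶜ) : BoundedLatticeHom B B' where
  toFun := f
  map_inf' := hinf
  map_sup' a b := by rw [← compl_inj_iff, compl_sup, ← hcompl, compl_sup, hinf, hcompl, hcompl]
  map_bot' := by rw [← inf_compl_self ⊥, hinf, hcompl, inf_compl_self]
  map_top' := by
    rw [← compl_bot, ← inf_compl_self ⊥, hcompl, hinf, hcompl, inf_compl_self, compl_bot]

/-- The images of the atoms are dense: no nonzero element is disjoint from all of them. For
`f = s^i_j` this is what `ψ_{i,j}` expresses. -/
def DenseOnAtoms (f : B → B') : Prop := ∀ b ≠ ⊥, ∃ a, IsAtom a ∧ ¬ Disjoint (f a) b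

theorem isLUB_compl_image {X : Set B} {m : B} : IsLUB (compl '' X) mᶜ ↔ IsGLB X m :=
  (OrderIso.compl B).isGLB_image'

theorem exists_mem_le_of_isLUB {X : Set B} {a m : B} (ha : IsAtom a) (hm : IsLUB X m)
    (ham : a ≤ m) : ∃ b ∈ X, a ≤ b := by
  by_contra! hX
  have hma : m ≤ aᶜ := hm.2 fun b hb =>
    le_compl_iff_disjoint_left.2 (ha.not_le_iff_disjoint.1 (hX b hb))
  exact ha.ne_bot (le_compl_self.1 (ham.trans hma))

theorem DenseOnAtoms.isLUB_image {f : BoundedLatticeHom B B'} (hf : DenseOnAtoms f) {X : Set B}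
    {m : B} (hm : IsLUB X m) : IsLUB (f '' X) (f m) := by
  refine ⟨(OrderHomClass.mono f).mem_upperBounds_image hm.1, fun u hu => by_contra fun hmu => ?_⟩
  have hne : f m ⊓ uᶜ ≠ ⊥ := fun hbot =>
    hmu (disjoint_compl_right_iff.1 (disjoint_iff.2 hbot))
  obtain ⟨a, ha, hdisj⟩ := hf _ hne
  have ham : a ≤ m := by
    by_contra ham
    exact hdisj (((ha.not_le_iff_disjoint.1 ham).map f).mono_right inf_le_left)
  obtain ⟨b, hb, hab⟩ := exists_mem_le_of_isLUB ha hm ham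
  have hau : f a ≤ u := (OrderHomClass.mono f hab).trans (hu (Set.mem_image_of_mem f hb))
  exact hdisj ((disjoint_compl_right.mono_left hau).mono_right inf_le_right)

theorem denseOnAtoms_iff_isLUB_image [IsAtomic B] {f : BoundedLatticeHom B B'} :
    DenseOnAtoms f ↔ ∀ X m, IsLUB X m → IsLUB (f '' X) (f m) := by
  refine ⟨fun hf X m => hf.isLUB_image, fun hf b hb => ?_⟩
  have htop : IsLUB {a : B | IsAtom a} ⊤ :=
    ⟨fun _ _ => le_top, fun u hu => BooleanAlgebra.le_iff_atom_le_imp.2 fun a ha _ => hu ha⟩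
  by_contra! hdisj
  have hle : f ⊤ ≤ bᶜ := (hf _ _ htop).2 (by
    rintro _ ⟨a, ha, rfl⟩
    exact le_compl_iff_disjoint_right.2 (hdisj a ha))
  rw [map_top, top_le_iff, compl_eq_top] at hle
  exact hb hle

theorem isLUB_image_of_involutive {f : BoundedLatticeHom B B} (hf : Function.Involutive f)
    {X : Set B} {m : B} (hm : IsLUB X m) : IsLUB (f '' X) (f m) := by
  have hmono : Monotone f := OrderHomClass.mono f
  refine ⟨hmono.mem_upperBounds_image hm.1, fun u hu => ?_⟩
  have hmu : m ≤ f u := hm.2 fun b hb => hf b ▸ hmono (hu (Set.mem_image_of_mem f hb))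
  exact hf u ▸ hmono hmu

/-- The maps preserving complements and all existing joins. -/
def completeEnd (B : Type*) [BooleanAlgebra B] : Submonoid (Function.End B) where
  carrier := {f | (∀ a, f aᶜ = (f a)ᶜ) ∧ ∀ X m, IsLUB X m → IsLUB (f '' X) (f m)}
  one_mem' := ⟨fun _ => rfl, fun X _ hm => (Set.image_id X).symm ▸ hm⟩
  mul_mem' := fun {f g} hf hg => ⟨fun a => by
      rw [end_mul_apply, end_mul_apply, hg.1, hf.1],
    fun X m hm => Set.image_comp f g X ▸ hf.2 _ _ (hg.2 _ _ hm)⟩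

theorem isGLB_image_of_isLUB_image {f : B → B'} (hcompl : ∀ a, f aᶜ = (f a)ᶜ)
    (hf : ∀ X m, IsLUB X m → IsLUB (f '' X) (f m)) {X : Set B} {m : B} (hm : IsGLB X m) :
    IsGLB (f '' X) (f m) := by
  rw [← isLUB_compl_image, ← hcompl, Set.image_comm fun a => (hcompl a).symm]
  exact hf _ _ (isLUB_compl_image.2 hm)

/- Since `q ∉ f ⊥`, the element `⊥` is not the meet of the `a` with `q ∈ f a`; any nonzero lower
bound of these `a` is an atom. -/
theorem exists_isAtom_mem {V : Type*} (f : BoundedLatticeHom B (Set V))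
    (hf : ∀ X m, IsGLB X m → f m = ⋂ a ∈ X, f a) (q : V) : ∃ a, IsAtom a ∧ q ∈ f a := by
  have hcompl {a : B} : q ∈ f aᶜ ↔ q ∉ f a := by rw [map_compl']; rfl
  have hbot : ¬ IsGLB {a | q ∈ f a} ⊥ := fun hglb => by
    have hq : q ∈ f ⊥ := hf _ _ hglb ▸ Set.mem_iInter₂.2 fun a ha => ha
    rw [map_bot] at hq
    exact hq
  obtain ⟨a, ha, hne⟩ : ∃ a ∈ lowerBounds {a | q ∈ f a}, a ≠ ⊥ := by
    by_contra! hlb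
    exact hbot ⟨fun _ _ => bot_le, fun a ha => (hlb a ha).le⟩
  have hqa : q ∈ f a := by
    by_contra hqa
    exact hne (le_compl_self.1 (ha (hcompl.2 hqa)))
  refine ⟨a, ⟨hne, fun b hb => by_contra fun hb' => ?_⟩, hqa⟩
  by_cases hqb : q ∈ f b
  · exact hb.not_ge (ha hqb)
  · exact hb' (le_compl_self.1 (hb.le.trans (ha (hcompl.2 hqb))))

theorem nonempty_apply_of_ne_bot {V : Type*} {f : BoundedLatticeHom B (Set V)}
    (hinj : Function.Injective f) {b : B} (hb : b ≠ ⊥) : (f b).Nonempty :=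
  Set.nonempty_iff_ne_empty.2 fun hempty => hb (hinj (hempty.trans (map_bot f).symm))

theorem isAtomic_of_forall_mem {V : Type*} {f : BoundedLatticeHom B (Set V)}
    (hinj : Function.Injective f) (hf : ∀ q, ∃ a, IsAtom a ∧ q ∈ f a) : IsAtomic B := by
  refine ⟨fun b => or_iff_not_imp_left.2 fun hb => ?_⟩
  obtain ⟨q, hqb⟩ := nonempty_apply_of_ne_bot hinj hb
  obtain ⟨a, ha, hqa⟩ := hf q
  refine ⟨a, ha, ha.not_disjoint_iff_le.1 fun hdisj => ?_⟩
  exact Set.disjoint_left.1 (hdisj.map f) hqa hqb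

end BooleanHoms

/-! ### The representation -/

section Representation

variable {n : ℕ}

theorem mem_setSubst_iff {U : Type u} {V : Set (Fin n → U)} {τ : Fin n → Fin n} {X : Set V} {q : V}
    (hq : (q : Fin n → U) ∘ τ ∈ V) : q ∈ setSubst V τ X ↔ ⟨_, hq⟩ ∈ X :=
  ⟨fun ⟨_, hp, hpq⟩ => Subtype.coe_eq_iff.1 hpq |>.2 ▸ hp, fun h => ⟨_, h, rfl⟩⟩

/-- The base set of the representation: sequences of the form `k ↦ (a, τ k)` with `a` an atom, so
that a point is an atom together with a self-map of `n`. -/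
def pointSet (n : ℕ) (B : Type u) [BooleanAlgebra B] :
    Set (Fin n → {a : B // IsAtom a} × Fin n) :=
  {q | ∀ k l, (q k).1 = (q l).1}

variable {B : Type u} [BooleanAlgebra B]

theorem comp_mem_pointSet {q : Fin n → {a : B // IsAtom a} × Fin n} (hq : q ∈ pointSet n B)
    (τ : Fin n → Fin n) : q ∘ τ ∈ pointSet n B := fun k l => hq (τ k) (τ l)

theorem locallySquare_pointSet : LocallySquare (pointSet n B) :=
  fun _ _ _ _ hq => ⟨comp_mem_pointSet hq _, comp_mem_pointSet hq _⟩

variable [NeZero n] (F : Function.End (Fin n) →* Function.End B)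

/-- The atom that is the common first entry of a point. -/
def pointAtom (q : pointSet n B) : B := (q.1 0).1

/-- The self-map formed by the second entries of a point. -/
def pointMap (q : pointSet n B) : Function.End (Fin n) := fun k => (q.1 k).2

/-- The representation attached to an action `F` of the self-maps of `n` on `B`: the point with
atom `a` and self-map `τ` lies in the image of `b` when `a ≤ F τ b`. -/
def rep (b : B) : Set (pointSet n B) := {q | pointAtom q ≤ F (pointMap q) b}

theorem mem_rep {b : B} {q : pointSet n B} :
    q ∈ rep F b ↔ pointAtom q ≤ F (pointMap q) b := Iff.rfl

omit [NeZero n] in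
theorem pointMap_comp (q : pointSet n B) (σ : Function.End (Fin n)) :
    pointMap ⟨q.1 ∘ σ, comp_mem_pointSet q.2 σ⟩ = pointMap q * σ := rfl

theorem pointAtom_comp (q : pointSet n B) (σ : Function.End (Fin n)) :
    pointAtom ⟨q.1 ∘ σ, comp_mem_pointSet q.2 σ⟩ = pointAtom q :=
  congrArg Subtype.val (q.2 (σ 0) 0)

theorem rep_apply (σ : Function.End (Fin n)) (b : B) :
    rep F (F σ b) = setSubst (pointSet n B) σ (rep F b) := by
  ext q
  rw [mem_setSubst_iff (comp_mem_pointSet q.2 σ), mem_rep, mem_rep, pointAtom_comp, pointMap_comp,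
    map_mul, end_mul_apply]

theorem rep_injective [IsAtomic B] : Function.Injective (rep F) := by
  refine fun b b' h => BooleanAlgebra.eq_iff_atom_le_iff.2 fun a ha => ?_
  let q : pointSet n B := ⟨fun k => (⟨a, ha⟩, k), fun _ _ => rfl⟩
  have hq (b : B) : q ∈ rep F b ↔ a ≤ b := by
    rw [mem_rep, show pointMap q = 1 from rfl, map_one, end_one_apply]
    rfl
  rw [← hq, ← hq, h]

variable (hF : ∀ τ, F τ ∈ completeEnd B)
include hF

theorem rep_compl (b : B) : rep F bᶜ = (rep F b)ᶜ := by
  ext q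
  have hq : IsAtom (pointAtom q) := (q.1 0).1.2
  rw [Set.mem_compl_iff, mem_rep, mem_rep, (hF _).1, hq.not_le_iff_disjoint,
    le_compl_iff_disjoint_right]

theorem rep_of_isGLB {X : Set B} {m : B} (hm : IsGLB X m) : rep F m = ⋂ b ∈ X, rep F b := by
  ext q
  have hglb := isGLB_image_of_isLUB_image (hF (pointMap q)).1 (hF (pointMap q)).2 hm
  rw [Set.mem_iInter₂, mem_rep, le_isGLB_iff hglb, mem_lowerBounds]
  exact Set.forall_mem_image

theorem rep_inf (b c : B) : rep F (b ⊓ c) = rep F b ∩ rep F c := by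
  rw [rep_of_isGLB F hF isGLB_pair, Set.biInter_pair]

end Representation

/-! ### Semantics of the equations -/

section Semantics

variable (n : ℕ) {M : Type u} [(lang n).Structure M]

/-- The operation `·` of an algebra. -/
def meetOp (a b : M) : M := Structure.funMap (L := lang n) Op.meet ![a, b]

/-- The operation `-` of an algebra. -/
def complOp (a : M) : M := Structure.funMap (L := lang n) Op.compl ![a]

/-- The derived operation `+` of an algebra. -/
def joinOp (a b : M) : M := complOp n (meetOp n (complOp n a) (complOp n b))

variable {n}

/-- The operation `s_{ij}` of an algebra, extended by the identity to `i = j`. -/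
def swapHom (M : Type u) [(lang n).Structure M] (i j : Fin n) : Function.End M :=
  if h : i ≠ j then fun a => Structure.funMap (L := lang n) (Op.swap i j h) ![a] else 1

/-- The operation `s^i_j` of an algebra, extended by the identity to `i = j`. -/
def replHom (M : Type u) [(lang n).Structure M] (i j : Fin n) : Function.End M :=
  if h : i ≠ j then replOp M i j h else 1

theorem swapHom_self (i : Fin n) : swapHom M i i = 1 := dif_neg (not_not.2 rfl)

theorem replHom_self (i : Fin n) : replHom M i i = 1 := dif_neg (not_not.2 rfl)

theorem swapHom_apply {i j : Fin n} (h : i ≠ j) (a : M) :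
    swapHom M i j a = Structure.funMap (L := lang n) (Op.swap i j h) ![a] :=
  congrFun (dif_pos h) a

theorem replHom_of_ne {i j : Fin n} (h : i ≠ j) : replHom M i j = replOp M i j h := dif_pos h

theorem map_meetOp {N : Type u} [(lang n).Structure N] (f : M →[lang n] N) (a b : M) :
    f (meetOp n a b) = meetOp n (f a) (f b) :=
  (f.map_fun Op.meet ![a, b]).trans (congrArg _ (FinVec.map_eq f ![a, b]).symm)

theorem map_complOp {N : Type u} [(lang n).Structure N] (f : M →[lang n] N) (a : M) :
    f (complOp n a) = complOp n (f a) :=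
  (f.map_fun Op.compl ![a]).trans (congrArg _ (FinVec.map_eq f ![a]).symm)

theorem map_replOp {N : Type u} [(lang n).Structure N] (f : M →[lang n] N) {i j : Fin n}
    (h : i ≠ j) (a : M) : f (replOp M i j h a) = replOp N i j h (f a) :=
  (f.map_fun (Op.repl i j h) ![a]).trans (congrArg _ (FinVec.map_eq f ![a]).symm)

section Terms

variable {α : Type} (v : α → M)

@[simp]
theorem realize_tMeet (t u : (lang n).Term α) :
    (tMeet t u).realize v = meetOp n (t.realize v) (u.realize v) :=
  Term.realize_functions_apply₂

@[simp]
theorem realize_tCompl (t : (lang n).Term α) : (tCompl t).realize v = complOp n (t.realize v) :=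
  Term.realize_functions_apply₁

@[simp]
theorem realize_tJoin (t u : (lang n).Term α) :
    (tJoin t u).realize v = joinOp n (t.realize v) (u.realize v) := by
  simp only [tJoin, joinOp, realize_tMeet, realize_tCompl]

@[simp]
theorem realize_tRepl (i j : Fin n) (h : i ≠ j) (t : (lang n).Term α) :
    (tRepl i j h t).realize v = replHom M i j (t.realize v) :=
  Term.realize_functions_apply₁.trans (congrFun (replHom_of_ne h) _).symm

@[simp]
theorem realize_tSwap (i j : Fin n) (h : i ≠ j) (t : (lang n).Term α) :
    (tSwap i j h t).realize v = swapHom M i j (t.realize v) :=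
  Term.realize_functions_apply₁.trans (swapHom_apply h _).symm

end Terms

@[simp]
theorem realize_var {k : ℕ} (v : Empty → M) (w : Fin k → M) (i : Fin k) :
    (var i : (lang n).Term (Empty ⊕ Fin k)).realize (Sum.elim v w) = w i := rfl

@[simp]
theorem realize_x (v : Empty → M) (w : Fin 3 → M) :
    (x : (lang n).Term (Empty ⊕ Fin 3)).realize (Sum.elim v w) = w 0 := rfl

@[simp]
theorem realize_y (v : Empty → M) (w : Fin 3 → M) :
    (y : (lang n).Term (Empty ⊕ Fin 3)).realize (Sum.elim v w) = w 1 := rfl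

@[simp]
theorem realize_z (v : Empty → M) (w : Fin 3 → M) :
    (z : (lang n).Term (Empty ⊕ Fin 3)).realize (Sum.elim v w) = w 2 := rfl

theorem realize_eqn_iff {t u : (lang n).Term (Empty ⊕ Fin 3)} :
    Sentence.Realize M (eqn t u) ↔
      ∀ w : Fin 3 → M, t.realize (Sum.elim default w) = u.realize (Sum.elim default w) := by
  rw [Sentence.Realize, eqn, BoundedFormula.realize_alls]
  simp only [BoundedFormula.realize_bdEqual]

theorem realize_eq_of_saEq (hM : M ⊨ saTheory n) {t u : (lang n).Term (Empty ⊕ Fin 3)}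
    (h : SAEq n (eqn t u)) (a b c : M) :
    t.realize (Sum.elim default ![a, b, c]) = u.realize (Sum.elim default ![a, b, c]) :=
  realize_eqn_iff.1 (hM.realize_of_mem _ h) ![a, b, c]

section Models

variable (hM : M ⊨ saTheory n)
include hM

theorem meetOp_comm (a b : M) : meetOp n a b = meetOp n b a := by
  simpa using realize_eq_of_saEq hM .meet_comm a b a

theorem meetOp_assoc (a b c : M) : meetOp n (meetOp n a b) c = meetOp n a (meetOp n b c) := by
  simpa using realize_eq_of_saEq hM .meet_assoc a b c

theorem joinOp_comm (a b : M) : joinOp n a b = joinOp n b a := by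
  simpa using realize_eq_of_saEq hM .join_comm a b a

theorem joinOp_assoc (a b c : M) : joinOp n (joinOp n a b) c = joinOp n a (joinOp n b c) := by
  simpa using realize_eq_of_saEq hM .join_assoc a b c

theorem meetOp_joinOp_self (a b : M) : meetOp n a (joinOp n a b) = a := by
  simpa using realize_eq_of_saEq hM .absorb_meet a b a

theorem joinOp_meetOp_self (a b : M) : joinOp n a (meetOp n a b) = a := by
  simpa using realize_eq_of_saEq hM .absorb_join a b a

theorem meetOp_joinOp_distrib (a b c : M) :
    meetOp n a (joinOp n b c) = joinOp n (meetOp n a b) (meetOp n a c) := by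
  simpa using realize_eq_of_saEq hM .distrib a b c

theorem meetOp_complOp_meetOp (a b : M) :
    meetOp n (meetOp n a (complOp n a)) b = meetOp n a (complOp n a) := by
  simpa using realize_eq_of_saEq hM .zero_le a b a

theorem joinOp_complOp_meetOp (a b : M) : meetOp n (joinOp n a (complOp n a)) b = b := by
  simpa using realize_eq_of_saEq hM .le_one a b a

/-- The Boolean algebra underlying a model of `Σ_n`. The units `⊥` and `⊤` are computed from an
arbitrary element. -/
@[reducible]
noncomputable def boolAlg [Nonempty M] : BooleanAlgebra M :=
  letI : Max M := ⟨joinOp n⟩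
  letI : Min M := ⟨meetOp n⟩
  letI : Lattice M := Lattice.mk' (joinOp_comm hM) (joinOp_assoc hM) (meetOp_comm hM)
    (meetOp_assoc hM) (joinOp_meetOp_self hM) (meetOp_joinOp_self hM)
  letI : DistribLattice M := .ofInfSupLe fun a b c => (meetOp_joinOp_distrib hM a b c).le
  have inf_compl_le (a b : M) : a ⊓ complOp n a ≤ b := inf_eq_left.1 (meetOp_complOp_meetOp hM a b)
  have le_sup_compl (a b : M) : b ≤ a ⊔ complOp n a := inf_eq_right.1 (joinOp_complOp_meetOp hM a b)
  { (inferInstance : DistribLattice M) with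
    compl := complOp n
    top := Classical.arbitrary M ⊔ complOp n (Classical.arbitrary M)
    bot := Classical.arbitrary M ⊓ complOp n (Classical.arbitrary M)
    le_top := le_sup_compl _
    bot_le := inf_compl_le _
    inf_compl_le_bot := fun a => inf_compl_le a _
    top_le_sup_compl := fun a => le_sup_compl a _ }

theorem replHom_meetOp (i j : Fin n) (a b : M) :
    replHom M i j (meetOp n a b) = meetOp n (replHom M i j a) (replHom M i j b) := by
  obtain rfl | h := eq_or_ne i j
  · rw [replHom_self]; rfl
  · simpa using realize_eq_of_saEq hM (.repl_meet i j h) a b a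

theorem replHom_complOp (i j : Fin n) (a : M) :
    replHom M i j (complOp n a) = complOp n (replHom M i j a) := by
  obtain rfl | h := eq_or_ne i j
  · rw [replHom_self]; rfl
  · simpa using realize_eq_of_saEq hM (.repl_compl i j h) a a a

theorem swapHom_meetOp (i j : Fin n) (a b : M) :
    swapHom M i j (meetOp n a b) = meetOp n (swapHom M i j a) (swapHom M i j b) := by
  obtain rfl | h := eq_or_ne i j
  · rw [swapHom_self]; rfl
  · simpa using realize_eq_of_saEq hM (.swap_meet i j h) a b a

theorem swapHom_complOp (i j : Fin n) (a : M) :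
    swapHom M i j (complOp n a) = complOp n (swapHom M i j a) := by
  obtain rfl | h := eq_or_ne i j
  · rw [swapHom_self]; rfl
  · simpa using realize_eq_of_saEq hM (.swap_compl i j h) a a a

theorem swapHom_symm (i j : Fin n) : swapHom M i j = swapHom M j i := by
  obtain rfl | h := eq_or_ne i j
  · rfl
  · exact funext fun a => by simpa using realize_eq_of_saEq hM (.swap_symm i j h) a a a

theorem swapHom_mul_self (i j : Fin n) : swapHom M i j * swapHom M i j = 1 := by
  obtain rfl | h := eq_or_ne i j
  · rw [swapHom_self, one_mul]
  · exact funext fun a => by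
      simpa [end_mul_apply, end_one_apply] using realize_eq_of_saEq hM (.swap_invol i j h) a a a

theorem swapHom_mul_eq_iff {i j : Fin n} {f g : Function.End M} :
    swapHom M i j * f = g * swapHom M i j ↔ swapHom M i j * (f * swapHom M i j) = g := by
  refine ⟨fun h => ?_, fun h => ?_⟩
  · rw [← mul_assoc, h, mul_assoc, swapHom_mul_self hM, mul_one]
  · rw [← h, mul_assoc, mul_assoc, swapHom_mul_self hM, mul_one]

theorem swapHom_mul_swapHom_left {i j k : Fin n} (hij : i ≠ j) (hik : i ≠ k) (hjk : j ≠ k) :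
    swapHom M i j * swapHom M i k = swapHom M j k * swapHom M i j :=
  (swapHom_mul_eq_iff hM).2 <| funext fun a => by
    simpa [end_mul_apply] using realize_eq_of_saEq hM (.swap_conj i j k hij hik hjk) a a a

theorem swapHom_mul_swapHom (k l i j : Fin n) :
    swapHom M k l * swapHom M i j =
      swapHom M (Equiv.swap k l i) (Equiv.swap k l j) * swapHom M k l := by
  obtain rfl | hij := eq_or_ne i j
  · rw [swapHom_self, swapHom_self, mul_one, one_mul]
  obtain rfl | hkl := eq_or_ne k l
  · rw [swapHom_self, Equiv.swap_self, one_mul, mul_one]; rfl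
  obtain rfl | hki := eq_or_ne k i
  · obtain rfl | hlj := eq_or_ne l j
    · rw [Equiv.swap_apply_left, Equiv.swap_apply_right, swapHom_symm hM l]
    · rw [Equiv.swap_apply_left, Equiv.swap_apply_of_ne_of_ne hij.symm hlj.symm,
        swapHom_mul_swapHom_left hM hkl hij hlj]
  obtain rfl | hli := eq_or_ne l i
  · obtain rfl | hkj := eq_or_ne k j
    · rw [Equiv.swap_apply_left, Equiv.swap_apply_right, swapHom_symm hM l]
    · rw [Equiv.swap_apply_right, Equiv.swap_apply_of_ne_of_ne hkj.symm hij.symm,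
        swapHom_symm hM k l, swapHom_mul_swapHom_left hM hkl.symm hij hkj]
  rw [Equiv.swap_apply_of_ne_of_ne hki.symm hli.symm]
  obtain rfl | hkj := eq_or_ne k j
  · rw [Equiv.swap_apply_left, swapHom_symm hM i, swapHom_symm hM i,
      swapHom_mul_swapHom_left hM hkl hki hli]
  obtain rfl | hlj := eq_or_ne l j
  · rw [Equiv.swap_apply_right, swapHom_symm hM i, swapHom_symm hM i, swapHom_symm hM k l,
      swapHom_mul_swapHom_left hM hkl.symm hli hki]
  rw [Equiv.swap_apply_of_ne_of_ne hkj.symm hlj.symm]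
  exact funext fun a => by
    simpa [end_mul_apply] using realize_eq_of_saEq hM (.swap_swap k l i j hkl hki hkj hli hlj hij)
      a a a

theorem swapHom_mul_replHom_self (i j : Fin n) :
    swapHom M i j * replHom M i j = replHom M j i * swapHom M i j := by
  obtain rfl | hij := eq_or_ne i j
  · rw [swapHom_self, one_mul, mul_one]
  refine (swapHom_mul_eq_iff hM).2 <| funext fun a => ?_
  rw [swapHom_symm hM]
  simpa [end_mul_apply] using realize_eq_of_saEq hM (.conj_self j i hij.symm) a a a

theorem swapHom_mul_replHom_source {i j k : Fin n} (hij : i ≠ j) (hik : i ≠ k) (hjk : j ≠ k) :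
    swapHom M i j * replHom M i k = replHom M j k * swapHom M i j :=
  (swapHom_mul_eq_iff hM).2 <| funext fun a => by
    simpa [end_mul_apply] using
      realize_eq_of_saEq hM (.conj_source k i j hik.symm hjk.symm hij) a a a

theorem swapHom_mul_replHom_target {i j k : Fin n} (hij : i ≠ j) (hik : i ≠ k) (hjk : j ≠ k) :
    swapHom M i j * replHom M k j = replHom M k i * swapHom M i j :=
  (swapHom_mul_eq_iff hM).2 <| funext fun a => by
    simpa [end_mul_apply] using
      realize_eq_of_saEq hM (.conj_target j k i hjk hij.symm hik.symm) a a a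

theorem swapHom_mul_replHom (k l i j : Fin n) :
    swapHom M k l * replHom M i j =
      replHom M (Equiv.swap k l i) (Equiv.swap k l j) * swapHom M k l := by
  obtain rfl | hij := eq_or_ne i j
  · rw [replHom_self, replHom_self, mul_one, one_mul]
  obtain rfl | hkl := eq_or_ne k l
  · rw [swapHom_self, Equiv.swap_self, one_mul, mul_one]; rfl
  obtain rfl | hki := eq_or_ne k i
  · obtain rfl | hlj := eq_or_ne l j
    · rw [Equiv.swap_apply_left, Equiv.swap_apply_right, swapHom_mul_replHom_self hM]
    · rw [Equiv.swap_apply_left, Equiv.swap_apply_of_ne_of_ne hij.symm hlj.symm,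
        swapHom_mul_replHom_source hM hkl hij hlj]
  obtain rfl | hli := eq_or_ne l i
  · rw [swapHom_symm hM, Equiv.swap_apply_right]
    obtain rfl | hkj := eq_or_ne k j
    · rw [Equiv.swap_apply_left, swapHom_mul_replHom_self hM]
    · rw [Equiv.swap_apply_of_ne_of_ne hkj.symm hij.symm,
        swapHom_mul_replHom_source hM hkl.symm hij hkj]
  rw [Equiv.swap_apply_of_ne_of_ne hki.symm hli.symm]
  obtain rfl | hlj := eq_or_ne l j
  · rw [Equiv.swap_apply_right, swapHom_mul_replHom_target hM hkl hki hli]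
  obtain rfl | hkj := eq_or_ne k j
  · rw [Equiv.swap_apply_left, swapHom_symm hM,
      swapHom_mul_replHom_target hM hkl.symm hli hki]
  rw [Equiv.swap_apply_of_ne_of_ne hkj.symm hlj.symm]
  exact (swapHom_mul_eq_iff hM).2 <| funext fun a => by
    simpa [end_mul_apply] using realize_eq_of_saEq hM
      (.conj_disjoint j i k l hij.symm hkj.symm hlj.symm hki.symm hli.symm hkl) a a a

theorem replHom_comm {i j k l : Fin n} (hik : i ≠ k) (hil : i ≠ l) (hjk : j ≠ k) :
    replHom M i j * replHom M k l = replHom M k l * replHom M i j := by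
  obtain rfl | hij := eq_or_ne i j
  · rw [replHom_self, one_mul, mul_one]
  obtain rfl | hkl := eq_or_ne k l
  · rw [replHom_self, one_mul, mul_one]
  obtain rfl | hjl := eq_or_ne j l
  · exact funext fun a => by
      simpa [end_mul_apply] using
        realize_eq_of_saEq hM (.repl_same_target j i k hij.symm hjk hik) a a a
  · exact funext fun a => by
      simpa [end_mul_apply] using
        realize_eq_of_saEq hM (.repl_disjoint j i k l hij.symm hjk hjl hik hil hkl) a a a

theorem replHom_mul_replHom_same_source {i k : Fin n} (j : Fin n) (hik : i ≠ k) :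
    replHom M i j * replHom M i k = replHom M i k := by
  obtain rfl | hij := eq_or_ne i j
  · rw [replHom_self, one_mul]
  obtain rfl | hjk := eq_or_ne j k
  · exact funext fun a => by
      simpa [end_mul_apply] using realize_eq_of_saEq hM (.repl_idem j i hij.symm) a a a
  · exact funext fun a => by
      simpa [end_mul_apply] using
        realize_eq_of_saEq hM (.repl_same_source j i k hij.symm hjk hik) a a a

theorem replHom_mul_replHom_same_target (i j k : Fin n) :
    replHom M i j * replHom M k j = replHom M i j * replHom M k i := by
  obtain rfl | hij := eq_or_ne i j
  · rfl
  obtain rfl | hjk := eq_or_ne j k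
  · rw [replHom_self, mul_one]
    exact funext fun a => by
      simpa [end_mul_apply] using (realize_eq_of_saEq hM (.repl_back j i hij.symm) a a a).symm
  obtain rfl | hik := eq_or_ne i k
  · rw [replHom_self, mul_one, replHom_mul_replHom_same_source hM j hij]
  · exact funext fun a => by
      simpa [end_mul_apply] using realize_eq_of_saEq hM (.repl_chain j i k hij.symm hjk hik) a a a

theorem replHom_mul_swapHom (i j : Fin n) : replHom M i j * swapHom M i j = replHom M i j := by
  obtain rfl | hij := eq_or_ne i j
  · rw [swapHom_self, mul_one]
  rw [swapHom_symm hM]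
  exact funext fun a => by
    simpa [end_mul_apply] using realize_eq_of_saEq hM (.repl_swap j i hij.symm) a a a

theorem substRelations_swapHom_replHom :
    SubstRelations (swapHom (n := n) M) (replHom (n := n) M) where
  swap_self := swapHom_self
  repl_self := replHom_self
  swap_mul_self := swapHom_mul_self hM
  swap_mul_swap := swapHom_mul_swapHom hM
  swap_mul_repl := swapHom_mul_replHom hM
  repl_comm := replHom_comm hM
  repl_same_source := replHom_mul_replHom_same_source hM
  repl_same_target := replHom_mul_replHom_same_target hM
  repl_mul_swap := replHom_mul_swapHom hM

end Models

end Semantics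

/-! ### Models as Boolean algebras -/

/-- The operations `·` and `-` of the algebra `M` are those of the Boolean algebra `M`. -/
class HasBooleanReduct (n : ℕ) (M : Type u) [(lang n).Structure M] [BooleanAlgebra M] : Prop where
  meetOp_eq_inf (a b : M) : meetOp n a b = a ⊓ b
  complOp_eq_compl (a : M) : complOp n a = aᶜ

section BooleanReduct

open HasBooleanReduct

variable {n : ℕ}

theorem hasBooleanReduct_boolAlg {M : Type u} [(lang n).Structure M] [Nonempty M]
    (hM : M ⊨ saTheory n) : @HasBooleanReduct n M _ (boolAlg hM) :=
  letI := boolAlg hM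
  ⟨fun _ _ => rfl, fun _ => rfl⟩

instance {U : Type u} (V : Set (Fin n → U)) : HasBooleanReduct n (Set V) :=
  ⟨fun _ _ => rfl, fun _ => rfl⟩

variable {M : Type u} [(lang n).Structure M] [BooleanAlgebra M] [HasBooleanReduct n M]

theorem le_iff_le {a b : M} : Le n a b ↔ a ≤ b := by
  rw [← inf_eq_left, ← meetOp_eq_inf (n := n)]
  rfl

theorem isMeet_iff_isGLB {X : Set M} {m : M} : IsMeet n X m ↔ IsGLB X m := by
  simp only [IsMeet, le_iff_le]
  rfl

theorem isJoin_iff_isLUB {X : Set M} {m : M} : IsJoin n X m ↔ IsLUB X m := by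
  simp only [IsJoin, le_iff_le]
  rfl

/-- A homomorphism of algebras as a homomorphism of bounded lattices. -/
def homLatticeHom {N : Type u} [(lang n).Structure N] [BooleanAlgebra N] [HasBooleanReduct n N]
    (f : M →[lang n] N) : BoundedLatticeHom M N :=
  latticeHomOfInfCompl f (by simpa only [meetOp_eq_inf] using map_meetOp f)
    (by simpa only [complOp_eq_compl] using map_complOp f)

/-- The operation `s^i_j` as a homomorphism of bounded lattices. -/
def replLatticeHom (hM : M ⊨ saTheory n) (i j : Fin n) : BoundedLatticeHom M M :=
  latticeHomOfInfCompl (replHom M i j)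
    (by simpa only [meetOp_eq_inf] using replHom_meetOp hM i j)
    (by simpa only [complOp_eq_compl] using replHom_complOp hM i j)

/-- The operation `s_{ij}` as a homomorphism of bounded lattices. -/
def swapLatticeHom (hM : M ⊨ saTheory n) (i j : Fin n) : BoundedLatticeHom M M :=
  latticeHomOfInfCompl (swapHom M i j)
    (by simpa only [meetOp_eq_inf] using swapHom_meetOp hM i j)
    (by simpa only [complOp_eq_compl] using swapHom_complOp hM i j)

theorem realize_isZero {k : ℕ} {t : (lang n).Term (Empty ⊕ Fin k)} {v : Empty → M}
    {w : Fin k → M} : (isZero t).Realize v w ↔ t.realize (Sum.elim v w) = ⊥ := by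
  simp only [isZero, BoundedFormula.realize_bdEqual, realize_tMeet, realize_tCompl,
    meetOp_eq_inf, complOp_eq_compl, inf_compl_self]

theorem realize_le {k : ℕ} {t u : (lang n).Term (Empty ⊕ Fin k)} {v : Empty → M}
    {w : Fin k → M} :
    (le t u).Realize v w ↔ t.realize (Sum.elim v w) ≤ u.realize (Sum.elim v w) := by
  simp only [le, BoundedFormula.realize_bdEqual, realize_tMeet, meetOp_eq_inf, inf_eq_left]

theorem realize_atF {v : Empty → M} {w : Fin 2 → M} :
    (atF : (lang n).BoundedFormula Empty 2).Realize v w ↔ IsAtom (w 1) := by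
  simp only [atF, BoundedFormula.realize_inf, BoundedFormula.realize_not,
    BoundedFormula.realize_all, BoundedFormula.realize_imp, BoundedFormula.realize_sup,
    BoundedFormula.realize_bdEqual, realize_isZero, realize_le, realize_var]
  refine and_congr_right fun _ => forall_congr' fun b => ?_
  change (b ≤ w 1 → b = ⊥ ∨ b = w 1) ↔ (b < w 1 → b = ⊥)
  rw [lt_iff_le_and_ne, and_imp, or_iff_not_imp_right]

theorem realize_atomicity_iff : Sentence.Realize M (atomicity (n := n)) ↔ IsAtomic M := by
  simp only [Sentence.Realize, Formula.Realize, atomicity, BoundedFormula.realize_inf,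
    BoundedFormula.realize_not, BoundedFormula.realize_ex, BoundedFormula.realize_all,
    BoundedFormula.realize_imp, realize_atF, realize_isZero, realize_le, realize_var]
  exact ⟨fun h => ⟨fun b => or_iff_not_imp_left.2 (h b)⟩,
    fun h b => (h.eq_bot_or_exists_atom_le b).resolve_left⟩

theorem realize_psi_iff {i j : Fin n} (h : i ≠ j) :
    Sentence.Realize M (psi i j h) ↔ DenseOnAtoms (replOp M i j h) := by
  simp only [Sentence.Realize, Formula.Realize, psi, BoundedFormula.realize_inf,
    BoundedFormula.realize_not, BoundedFormula.realize_ex, BoundedFormula.realize_all,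
    BoundedFormula.realize_imp, realize_atF, realize_isZero, realize_tMeet, realize_tRepl,
    realize_var, meetOp_eq_inf, replHom_of_ne h, ← disjoint_iff]
  rfl

end BooleanReduct

/-! ### Completely representable algebras -/

section CompleteRepresentability

variable {n : ℕ} {M : Type u} [(lang n).Structure M]

theorem psi_mem_csaTheory {i j : Fin n} (h : i ≠ j) : psi i j h ∈ csaTheory n :=
  .inr ⟨i, j, h, rfl⟩

theorem atomicity_mem_csaTheory : atomicity ∈ csaTheory n := .inl (.inr rfl)

theorem model_saTheory_of_model_csaTheory (hM : M ⊨ csaTheory n) : M ⊨ saTheory n :=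
  hM.mono fun _ hφ => .inl (.inl hφ)

section BooleanReduct

variable [BooleanAlgebra M] [HasBooleanReduct n M]

theorem swapHom_mem_completeEnd (hM : M ⊨ saTheory n) (i j : Fin n) :
    swapHom M i j ∈ completeEnd M := by
  have hinv : Function.Involutive (swapLatticeHom hM i j) := congrFun (swapHom_mul_self hM i j)
  exact ⟨map_compl' (swapLatticeHom hM i j), fun _ _ => isLUB_image_of_involutive hinv⟩

theorem replHom_mem_completeEnd (hM : M ⊨ csaTheory n) (i j : Fin n) :
    replHom M i j ∈ completeEnd M := by
  obtain rfl | h := eq_or_ne i j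
  · rw [replHom_self]
    exact one_mem _
  have hSA := model_saTheory_of_model_csaTheory hM
  have hdense : DenseOnAtoms (replLatticeHom hSA i j) := by
    have hpsi := (realize_psi_iff h).1 (hM.realize_of_mem _ (psi_mem_csaTheory h))
    rwa [← replHom_of_ne h] at hpsi
  exact ⟨map_compl' (replLatticeHom hSA i j), fun _ _ => hdense.isLUB_image⟩

/-- The representation attached to an action of the self-maps of `n` that extends the operations
of the algebra, as an embedding into a set algebra. -/
def repEmbedding [NeZero n] [IsAtomic M] (F : Function.End (Fin n) →* Function.End M)
    (hswap : ∀ i j, F (swapEnd i j) = swapHom M i j)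
    (hrepl : ∀ i j, F (replEnd i j) = replHom M i j) (hF : ∀ τ, F τ ∈ completeEnd M) :
    M ↪[lang n] Set (pointSet n M) where
  toFun := rep F
  inj' := rep_injective F
  map_fun' {k} f v := by
    cases f with
    | meet =>
      rw [← FinVec.etaExpand_eq v]
      exact (congrArg (rep F) (HasBooleanReduct.meetOp_eq_inf (v 0) (v 1))).trans
        (rep_inf F hF _ _)
    | compl =>
      rw [← FinVec.etaExpand_eq v]
      exact (congrArg (rep F) (HasBooleanReduct.complOp_eq_compl (v 0))).trans (rep_compl F hF _)
    | repl i j h =>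
      rw [← FinVec.etaExpand_eq v]
      refine Eq.trans (congrArg (rep F) ?_) (rep_apply F (replEnd i j) (v 0))
      rw [hrepl, replHom_of_ne h]
      rfl
    | swap i j h =>
      rw [← FinVec.etaExpand_eq v]
      refine Eq.trans (congrArg (rep F) ?_) (rep_apply F (swapEnd i j) (v 0))
      rw [hswap, swapHom_apply h]
      rfl
  map_rel' r := r.elim

theorem isAtomic_of_isCompleteRep {U : Type u} {V : Set (Fin n → U)} {f : M ↪[lang n] Set V}
    (hf : IsCompleteRep V f) : IsAtomic M :=
  isAtomic_of_forall_mem (f := homLatticeHom f.toHom) f.injective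
    (exists_isAtom_mem _ fun X m hm => hf X m (isMeet_iff_isGLB.2 hm))

theorem denseOnAtoms_of_isCompleteRep {U : Type u} {V : Set (Fin n → U)} (hV : LocallySquare V)
    {f : M ↪[lang n] Set V} (hf : IsCompleteRep V f) {i j : Fin n} (h : i ≠ j) :
    DenseOnAtoms (replOp M i j h) := by
  let φ := homLatticeHom (f.toHom : M →[lang n] Set V)
  intro b hb
  obtain ⟨q, hqb⟩ := nonempty_apply_of_ne_bot (f := φ) f.injective hb
  have hq := (hV i j h q q.2).1
  obtain ⟨a, ha, hqa⟩ := exists_isAtom_mem φ (fun X m hm => hf X m (isMeet_iff_isGLB.2 hm)) ⟨_, hq⟩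
  have hqr : q ∈ f (replOp M i j h a) :=
    (map_replOp f.toHom h a).symm ▸ (mem_setSubst_iff hq).2 hqa
  exact ⟨a, ha, fun hdisj => Set.disjoint_left.1 (hdisj.map φ) hqr hqb⟩

end BooleanReduct

variable [Nonempty M]

theorem isCSA_of_model [NeZero n] (hM : M ⊨ csaTheory n) : IsCSA n M := by
  have hSA := model_saTheory_of_model_csaTheory hM
  let _ := boolAlg hSA
  have := hasBooleanReduct_boolAlg hSA
  have := realize_atomicity_iff.1 (hM.realize_of_mem _ atomicity_mem_csaTheory)
  obtain ⟨F, hswap, hrepl⟩ := (substRelations_swapHom_replHom hSA).exists_monoidHom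
  have hF : ∀ τ, F τ ∈ completeEnd M := map_mem_of_swap_of_repl F
    (fun i j => hswap i j ▸ swapHom_mem_completeEnd hSA i j)
    (fun i j => hrepl i j ▸ replHom_mem_completeEnd hM i j)
  exact ⟨hSA, _, _, locallySquare_pointSet, repEmbedding F hswap hrepl hF,
    fun _ _ hm => rep_of_isGLB F hF (isMeet_iff_isGLB.1 hm)⟩

theorem model_of_isCSA (hM : IsCSA n M) : M ⊨ csaTheory n := by
  obtain ⟨hSA, U, V, hV, f, hf⟩ := hM
  let _ := boolAlg hSA
  have := hasBooleanReduct_boolAlg hSA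
  refine ⟨fun φ hφ => ?_⟩
  obtain (hφ | rfl) | ⟨i, j, h, rfl⟩ := hφ
  · exact hSA.realize_of_mem φ hφ
  · exact realize_atomicity_iff.2 (isAtomic_of_isCompleteRep hf)
  · exact (realize_psi_iff h).2 (denseOnAtoms_of_isCompleteRep hV hf h)

theorem realize_psi_iff_completelyAdditive (hM : M ⊨ saTheory n)
    (hatomic : Sentence.Realize M (atomicity (n := n))) {i j : Fin n} (h : i ≠ j) :
    Sentence.Realize M (psi i j h) ↔ CompletelyAdditive n (replOp M i j h) := by
  let _ := boolAlg hM
  have := hasBooleanReduct_boolAlg hM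
  have := realize_atomicity_iff.1 hatomic
  simp only [realize_psi_iff, CompletelyAdditive, isJoin_iff_isLUB, ← replHom_of_ne h]
  exact denseOnAtoms_iff_isLUB_image (f := replLatticeHom hM i j)

end CompleteRepresentability

/-! ### Finiteness of the axiom system -/

section Finiteness

/-- The nesting depth of function symbols in a term. -/
def termDepth {L : Language} {α : Type*} : L.Term α → ℕ
  | .var _ => 0
  | .func _ ts => (Finset.univ.sup fun i => termDepth (ts i)) + 1

theorem finite_setOf_termDepth_le {L : Language} {α : Type*} [Finite (Σ l, L.Functions l)]
    [Finite α] (k : ℕ) : {t : L.Term α | termDepth t ≤ k}.Finite := by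
  have hvar : (Set.range (Term.var : α → L.Term α)).Finite := Set.finite_range _
  induction k with
  | zero =>
    refine hvar.subset fun t ht => ?_
    cases t with
    | var a => exact ⟨a, rfl⟩
    | func f ts => exact absurd ht (Nat.not_succ_le_zero _)
  | succ k ih =>
    have := ih.to_subtype
    refine (hvar.union (Set.finite_range fun p : (Σ g : Σ l, L.Functions l,
      Fin g.1 → {t : L.Term α | termDepth t ≤ k}) =>
        Term.func p.1.2 fun i => (p.2 i).1)).subset fun t ht => ?_
    cases t with
    | var a => exact .inl ⟨a, rfl⟩
    | func f ts =>
      have hts i : termDepth (ts i) ≤ k :=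
        (Finset.le_sup (f := fun i => termDepth (ts i)) (Finset.mem_univ i)).trans
          (Nat.le_of_succ_le_succ ht)
      exact .inr ⟨⟨⟨_, f⟩, fun i => ⟨ts i, hts i⟩⟩, rfl⟩

variable {n : ℕ}

instance finite_op : Finite (Σ l, (lang n).Functions l) := by
  let IndexPair := {p : Fin n × Fin n // p.1 ≠ p.2}
  let op : Bool ⊕ Bool × IndexPair → Σ l, (lang n).Functions l
    | .inl true => ⟨2, Op.meet⟩
    | .inl false => ⟨1, Op.compl⟩
    | .inr (true, p) => ⟨1, Op.repl p.1.1 p.1.2 p.2⟩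
    | .inr (false, p) => ⟨1, Op.swap p.1.1 p.1.2 p.2⟩
  refine .of_surjective op fun g => ?_
  obtain ⟨_, _ | _ | ⟨i, j, h⟩ | ⟨i, j, h⟩⟩ := g
  exacts [⟨.inl true, rfl⟩, ⟨.inl false, rfl⟩, ⟨.inr (true, ⟨(i, j), h⟩), rfl⟩,
    ⟨.inr (false, ⟨(i, j), h⟩), rfl⟩]

section Depth

variable {α : Type}

@[simp]
theorem termDepth_tMeet (t u : (lang n).Term α) :
    termDepth (tMeet t u) = max (termDepth t) (termDepth u) + 1 := by
  simp [tMeet, Functions.apply₂, termDepth, Fin.univ_succ]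

@[simp]
theorem termDepth_tCompl (t : (lang n).Term α) : termDepth (tCompl t) = termDepth t + 1 := by
  simp [tCompl, Functions.apply₁, termDepth]

@[simp]
theorem termDepth_tRepl (i j : Fin n) (h : i ≠ j) (t : (lang n).Term α) :
    termDepth (tRepl i j h t) = termDepth t + 1 := by
  simp [tRepl, Functions.apply₁, termDepth]

@[simp]
theorem termDepth_tSwap (i j : Fin n) (h : i ≠ j) (t : (lang n).Term α) :
    termDepth (tSwap i j h t) = termDepth t + 1 := by
  simp [tSwap, Functions.apply₁, termDepth]

@[simp]
theorem termDepth_var {k : ℕ} (i : Fin k) :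
    termDepth (var i : (lang n).Term (Empty ⊕ Fin k)) = 0 := rfl

end Depth

theorem exists_termDepth_le_of_saEq {φ : (lang n).Sentence} (h : SAEq n φ) :
    ∃ t u, termDepth t ≤ 6 ∧ termDepth u ≤ 6 ∧ eqn t u = φ := by
  cases h <;> exact ⟨_, _, by simp [tJoin, x, y, z], by simp [tJoin, x, y, z], rfl⟩

theorem finite_saTheory : (saTheory n).Finite := by
  have hterms := finite_setOf_termDepth_le (L := lang n) (α := Empty ⊕ Fin 3) 6
  refine (hterms.image2 eqn hterms).subset fun φ hφ => ?_
  obtain ⟨t, u, ht, hu, htu⟩ := exists_termDepth_le_of_saEq hφ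
  exact ⟨t, ht, u, hu, htu⟩

theorem finite_csaTheory : (csaTheory n).Finite := by
  refine (finite_saTheory.union (Set.finite_singleton _)).union ?_
  refine (Set.finite_range fun p : {p : Fin n × Fin n // p.1 ≠ p.2} => psi _ _ p.2).subset ?_
  rintro _ ⟨i, j, h, rfl⟩
  exact ⟨⟨(i, j), h⟩, rfl⟩

end Finiteness

end SubstAlg

theorem mainTheorem2 (n : ℕ) (hn : 1 ≤ n) :
    -- the axiom system is finite
    (SubstAlg.csaTheory n).Finite ∧
    -- its models are exactly the completely representable algebras
    (∀ (M : Type*) [(SubstAlg.lang n).Structure M] [Nonempty M],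
      FirstOrder.Language.Theory.Model M (SubstAlg.csaTheory n) ↔ SubstAlg.IsCSA n M) ∧
    -- in an atomic algebra of `SA_n`, `ψ_{i,j}` says that `s^i_j` is completely additive
    (∀ (M : Type*) [(SubstAlg.lang n).Structure M] [Nonempty M],
      FirstOrder.Language.Theory.Model M (SubstAlg.saTheory n) →
      FirstOrder.Language.Sentence.Realize M (SubstAlg.atomicity (n := n)) →
      ∀ (i j : Fin n) (h : i ≠ j),
        FirstOrder.Language.Sentence.Realize M (SubstAlg.psi i j h) ↔
          SubstAlg.CompletelyAdditive n (SubstAlg.replOp M i j h)) := by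
  have : NeZero n := ⟨Nat.one_le_iff_ne_zero.1 hn⟩
  exact ⟨SubstAlg.finite_csaTheory,
    fun _ _ _ => ⟨SubstAlg.isCSA_of_model, SubstAlg.model_of_isCSA⟩,
    fun _ _ _ hM hatomic _ _ h => SubstAlg.realize_psi_iff_completelyAdditive hM hatomic h⟩
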